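/- Let $T$ be an invertible bounded linear operator (with bounded inverse) on a real or complex Banach space $X$. Write $d(x,y)=\|x-y\|$. Then the following assertions are equivalent: (i) $T$ is *hyperbolic*: the spectrum of $T$ (if $X$ is complex), respectively of the complexification $T_{\mathbb C}$ of $T$ (if $X$ is real), does not intersect the unit circle $\{z\in\mathbb C:|z|=1\}$. (ii) $T$ has *hyperbolic coordinates*. That is, with $$W^s_\varepsilon(x)=\{y\in X: d(T^nx,T^ny)\le\varepsilon\ \text{for all } n\ge 0\},\qquad W^u_\varepsilon(x)=\{y\in X: d(T^{-n}x,T^{-n}y)\le\varepsilon\ \text{for all } n\ge 0\},$$ both of the following hold: for every $\varepsilon>0$ there is $\delta>0$ such that $d(x,y)\le\delta$ implies $W^s_\varepsilon(x)\cap W^u_\varepsilon(y)\ne\emptyset$; and there are constants $c\ge 1$, $0<\beta<1$ and $\gamma>0$ such that, for every $x\in X$ and every integer $n\ge 0$, $d(T^nx,T^ny)\le c\beta^n d(x,y)$ for all $y\in W^s_\gamma(x)$ and $d(T^{-n}x,T^{-n}y)\le c\beta^n d(x,y)$ for all $y\in W^u_\gamma(x)$. (iii) $T$ is *expansive* and has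 the *shadowing property*. That is, there is $e>0$ such that for all distinct $x,y\in X$ there is $n\in\mathbb Z$ with $d(T^nx,T^ny)\ge e$; and for every $\varepsilon>0$ there is $\delta>0$ such that for every sequence $(x_n)_{n\in\mathbb Z}$ in $X$ with $d(Tx_n,x_{n+1})\le\delta$ for all $n\in\mathbb Z$ there is $x\in X$ with $d(x_n,T^nx)<\varepsilon$ for all $n\in\mathbb Z$. -/

import Mathlib

noncomputable section

namespace LinearDynamics

/-! ### Topological dynamics of homeomorphisms of a metric space

For `h : M ≃ₜ M` and `n : ℤ`, the iterate is the power `h ^ n` in the group of homeomorphisms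
of `M` (whose product is composition), so that negative powers are iterates of the inverse. -/

section Dynamics

variable {M : Type*} [MetricSpace M]

/-- A `δ`-pseudotrajectory of `h`. -/
def IsPseudotrajectory (h : M ≃ₜ M) (δ : ℝ) (x : ℤ → M) : Prop :=
  ∀ n : ℤ, dist (h (x n)) (x (n + 1)) ≤ δ

/-- The shadowing property. -/
def HasShadowing (h : M ≃ₜ M) : Prop :=
  ∀ ε : ℝ, 0 < ε → ∃ δ : ℝ, 0 < δ ∧ ∀ x : ℤ → M, IsPseudotrajectory h δ x →
    ∃ y : M, ∀ n : ℤ, dist (x n) ((h ^ n) y) < ε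

/-- Expansivity (with two-sided iterates). -/
def IsExpansive (h : M ≃ₜ M) : Prop :=
  ∃ e : ℝ, 0 < e ∧ ∀ x y : M, x ≠ y → ∃ n : ℤ, e ≤ dist ((h ^ n) x) ((h ^ n) y)

/-- The `ε`-stable set of `h` at `x`. -/
def localStableSet (h : M ≃ₜ M) (ε : ℝ) (x : M) : Set M :=
  {y | ∀ n : ℕ, dist ((h ^ (n : ℤ)) x) ((h ^ (n : ℤ)) y) ≤ ε}

/-- The `ε`-unstable set of `h` at `x`. -/
def localUnstableSet (h : M ≃ₜ M) (ε : ℝ) (x : M) : Set M :=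
  {y | ∀ n : ℕ, dist ((h ^ (-(n : ℤ))) x) ((h ^ (-(n : ℤ))) y) ≤ ε}

/-- Canonical coordinates. -/
def HasCanonicalCoordinates (h : M ≃ₜ M) : Prop :=
  ∀ ε : ℝ, 0 < ε → ∃ δ : ℝ, 0 < δ ∧ ∀ x y : M, dist x y ≤ δ →
    (localStableSet h ε x ∩ localUnstableSet h ε y).Nonempty

/-- Hyperbolic coordinates. -/
def HasHyperbolicCoordinates (h : M ≃ₜ M) : Prop :=
  HasCanonicalCoordinates h ∧
    ∃ c β γ : ℝ, 1 ≤ c ∧ 0 < β ∧ β < 1 ∧ 0 < γ ∧ ∀ x : M,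
      (∀ y ∈ localStableSet h γ x, ∀ n : ℕ,
        dist ((h ^ (n : ℤ)) x) ((h ^ (n : ℤ)) y) ≤ c * β ^ n * dist x y) ∧
      (∀ y ∈ localUnstableSet h γ x, ∀ n : ℕ,
        dist ((h ^ (-(n : ℤ))) x) ((h ^ (-(n : ℤ))) y) ≤ c * β ^ n * dist x y)

end Dynamics

/-! ### The complexification of a real normed space -/

/-- The complexification of a real vector space `X`: the formal sums `re + i im` with
`re, im ∈ X`. -/
@[ext]
structure Complexification (X : Type*) where
  /-- the real part -/
  re : X
  /-- the imaginary part -/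
  im : X

namespace Complexification

variable {X : Type*} [NormedAddCommGroup X]

instance : Zero (Complexification X) := ⟨⟨0, 0⟩⟩

instance : Add (Complexification X) := ⟨fun z w => ⟨z.re + w.re, z.im + w.im⟩⟩

instance : Neg (Complexification X) := ⟨fun z => ⟨-z.re, -z.im⟩⟩

@[simp] theorem zero_re : (0 : Complexification X).re = 0 := rfl

@[simp] theorem zero_im : (0 : Complexification X).im = 0 := rfl

@[simp] theorem add_re (z w : Complexification X) : (z + w).re = z.re + w.re := rfl

@[simp] theorem add_im (z w : Complexification X) : (z + w).im = z.im + w.im := rfl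

@[simp] theorem neg_re (z : Complexification X) : (-z).re = -z.re := rfl

@[simp] theorem neg_im (z : Complexification X) : (-z).im = -z.im := rfl

instance : AddCommGroup (Complexification X) where
  add_assoc z w v := by ext <;> simp [add_assoc]
  zero_add z := by ext <;> simp
  add_zero z := by ext <;> simp
  add_comm z w := by ext <;> simp [add_comm]
  neg_add_cancel z := by ext <;> simp
  nsmul := nsmulRec
  zsmul := zsmulRec

variable [NormedSpace ℝ X]

/-- `(a + i b) (x + i y) = (a x - b y) + i (b x + a y)`. -/
instance : SMul ℂ (Complexification X) :=
  ⟨fun c z => ⟨c.re • z.re - c.im • z.im, c.im • z.re + c.re • z.im⟩⟩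

@[simp] theorem smul_re (c : ℂ) (z : Complexification X) :
    (c • z).re = c.re • z.re - c.im • z.im := rfl

@[simp] theorem smul_im (c : ℂ) (z : Complexification X) :
    (c • z).im = c.im • z.re + c.re • z.im := rfl

instance : Module ℂ (Complexification X) where
  one_smul z := by ext <;> simp
  mul_smul c d z := by
    ext
    · simp only [smul_re, smul_im, Complex.mul_re, Complex.mul_im]; module
    · simp only [smul_re, smul_im, Complex.mul_re, Complex.mul_im]; module
  smul_zero c := by ext <;> simp
  smul_add c z w := by
    ext
    · simp only [smul_re, add_re, add_im]; module
    · simp only [smul_im, add_re, add_im]; module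
  add_smul c d z := by
    ext
    · simp only [smul_re, add_re, Complex.add_re, Complex.add_im]; module
    · simp only [smul_im, add_im, Complex.add_re, Complex.add_im]; module
  zero_smul z := by ext <;> simp

/-- The Taylor norm `‖x + i y‖ = sup_θ ‖(cos θ) x - (sin θ) y‖`, i.e. the supremum of the norms
of the real parts of `e^{iθ} (x + i y)`. -/
instance : Norm (Complexification X) :=
  ⟨fun z => ⨆ θ : ℝ, ‖Real.cos θ • z.re - Real.sin θ • z.im‖⟩

theorem norm_def (z : Complexification X) :
    ‖z‖ = ⨆ θ : ℝ, ‖Real.cos θ • z.re - Real.sin θ • z.im‖ := rfl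

theorem norm_rotate_le_add (z : Complexification X) (θ : ℝ) :
    ‖Real.cos θ • z.re - Real.sin θ • z.im‖ ≤ ‖z.re‖ + ‖z.im‖ := by
  refine (norm_sub_le _ _).trans (add_le_add ?_ ?_)
  · rw [norm_smul]
    exact mul_le_of_le_one_left (norm_nonneg _) (Real.abs_cos_le_one θ)
  · rw [norm_smul]
    exact mul_le_of_le_one_left (norm_nonneg _) (Real.abs_sin_le_one θ)

theorem norm_rotate_le (z : Complexification X) (θ : ℝ) :
    ‖Real.cos θ • z.re - Real.sin θ • z.im‖ ≤ ‖z‖ :=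
  le_ciSup (f := fun θ : ℝ => ‖Real.cos θ • z.re - Real.sin θ • z.im‖)
    ⟨‖z.re‖ + ‖z.im‖, by rintro _ ⟨θ, rfl⟩; exact norm_rotate_le_add z θ⟩ θ

theorem norm_re_le (z : Complexification X) : ‖z.re‖ ≤ ‖z‖ := by
  simpa using norm_rotate_le z 0

theorem norm_im_le (z : Complexification X) : ‖z.im‖ ≤ ‖z‖ := by
  simpa using norm_rotate_le z (Real.pi / 2)

theorem core : NormedSpace.Core ℂ (Complexification X) where
  norm_nonneg z := (norm_nonneg _).trans (norm_re_le z)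
  norm_smul c z := by
    rw [norm_def, norm_def, Real.mul_iSup_of_nonneg (norm_nonneg c),
      ← (Equiv.addRight c.arg).iSup_comp (g := fun θ : ℝ =>
        ‖c‖ * ‖Real.cos θ • z.re - Real.sin θ • z.im‖)]
    refine iSup_congr fun θ => ?_
    have h1 : c.re = ‖c‖ * Real.cos c.arg := (Complex.norm_mul_cos_arg c).symm
    have h2 : c.im = ‖c‖ * Real.sin c.arg := (Complex.norm_mul_sin_arg c).symm
    rw [← norm_norm c, ← norm_smul]
    congr 1
    simp only [smul_re, smul_im, Equiv.coe_addRight, Real.cos_add, Real.sin_add]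
    rw [h1, h2]
    module
  norm_triangle z w := by
    rw [norm_def (z + w)]
    refine ciSup_le fun θ => ?_
    calc ‖Real.cos θ • (z + w).re - Real.sin θ • (z + w).im‖
        = ‖(Real.cos θ • z.re - Real.sin θ • z.im)
            + (Real.cos θ • w.re - Real.sin θ • w.im)‖ := by
          congr 1; simp only [add_re, add_im]; module
      _ ≤ ‖z‖ + ‖w‖ := (norm_add_le _ _).trans
          (add_le_add (norm_rotate_le z θ) (norm_rotate_le w θ))
  norm_eq_zero_iff z := by
    constructor
    · intro h
      ext
      · exact norm_le_zero_iff.1 (h ▸ norm_re_le z)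
      · exact norm_le_zero_iff.1 (h ▸ norm_im_le z)
    · rintro rfl
      simp [norm_def]

instance : NormedAddCommGroup (Complexification X) := NormedAddCommGroup.ofCore core

instance : NormedSpace ℂ (Complexification X) := NormedSpace.ofCore core

end Complexification

/-- The complexification `T_ℂ (x + i y) = T x + i T y` of a continuous linear operator on a real
normed space. -/
def complexify {X : Type*} [NormedAddCommGroup X] [NormedSpace ℝ X] (T : X →L[ℝ] X) :
    Complexification X →L[ℂ] Complexification X :=
  LinearMap.mkContinuous
    { toFun := fun z => ⟨T z.re, T z.im⟩
      map_add' := fun z w => by ext <;> simp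
      map_smul' := fun c z => by ext <;> simp } ‖T‖ fun z => by
    rw [Complexification.norm_def]
    refine ciSup_le fun θ => ?_
    have h := T.le_opNorm (Real.cos θ • z.re - Real.sin θ • z.im)
    rw [map_sub, map_smul, map_smul] at h
    exact h.trans (mul_le_mul_of_nonneg_left (Complexification.norm_rotate_le z θ) (norm_nonneg T))

/-! ### Hyperbolicity of operators -/

/-- A continuous linear operator on a complex normed space is hyperbolic if its spectrum, in the
algebra of continuous linear operators, does not meet the unit circle. -/
def IsHyperbolic {X : Type*} [NormedAddCommGroup X] [NormedSpace ℂ X] (T : X →L[ℂ] X) : Prop :=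
  spectrum ℂ T ∩ {z : ℂ | ‖z‖ = 1} = ∅

/-- A continuous linear operator on a real normed space is hyperbolic if its complexification
is. -/
def IsHyperbolicReal {X : Type*} [NormedAddCommGroup X] [NormedSpace ℝ X] (T : X →L[ℝ] X) :
    Prop :=
  IsHyperbolic (complexify T)

end LinearDynamics

end

/-!
All three assertions are equivalent to the existence of an exponential dichotomy (`IsDichotomy`):
a bounded operator `P` commuting with `T` such that `T ^ n P` and `T ^ (-n) (1 - P)` decay
exponentially as `n → ∞`. A vector with bounded forward orbit is then fixed by `P`, and one with
bounded backward orbit is killed by it.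

If `T` is a hyperbolic complex operator, the resolvent `(z - T)⁻¹` is analytic on an annulus around
the unit circle. By Cauchy's theorem its Laurent coefficients can be computed on circles of radius
less than `1` and greater than `1`, so they decay exponentially in both directions, and the
recursion `laurentCoeff_succ` identifies them with `T ^ n P` and `-T ^ (-n) (1 - P)`, where `P` is
the coefficient of `z⁻¹` (`exists_riesz_projection`). For a real operator, the real part of
the projection of the complexification, restricted to `X`, gives a dichotomy
(`exists_isDichotomy_of_isHyperbolic`).

Given a dichotomy, the point `x + P (y - x)` lies on the stable set of `x` and on the unstable set
of `y`, which gives hyperbolic coordinates; a pseudotrajectory is shadowed after subtracting a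
bounded solution of the inhomogeneous equation `y (n + 1) = T (y n) + z n`, obtained by convolution
with `T ^ n P` and `-T ^ (-n) (1 - P)` (`IsDichotomy.exists_bounded_solution`). Conversely,
hyperbolic coordinates and homogeneity show that `X` is the direct sum of the vectors with bounded
forward orbit and those with bounded backward orbit, and the projection onto the former is a
dichotomy (`exists_isDichotomy_of_hasHyperbolicCoordinates`).

Finally, by homogeneity, expansivity and shadowing give uniqueness and existence of a bounded
solution of the inhomogeneous equation for every bounded `z`. This property passes to the
complexification, and applied to the sequences `n ↦ μ ^ n w` with `|μ| = 1` it shows that `μ - T`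
is bijective (`HasUniqueBoundedSolutions.isHyperbolic`).
-/

namespace LinearDynamics

/-! ### The Laurent coefficients of the resolvent -/

section Laurent

variable {A : Type*} [NormedRing A] [NormedAlgebra ℂ A]

/-- The coefficient of `z ^ (-n - 1)` in the Laurent expansion of the resolvent
`z ↦ (z - a)⁻¹` on the circle `|z| = r`. For `n = 0` this is the Riesz spectral projection
of `a` belonging to the part of the spectrum inside that circle. -/
noncomputable def laurentCoeff (a : A) (r : ℝ) (n : ℤ) : A :=
  (2 * Real.pi * Complex.I : ℂ)⁻¹ • ∮ z in C(0, r), z ^ n • resolvent a z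

theorem mul_circleIntegral [CompleteSpace A] (a : A) {f : ℂ → A} {c : ℂ} {r : ℝ}
    (hf : CircleIntegrable f c r) : a * (∮ z in C(c, r), f z) = ∮ z in C(c, r), a * f z := by
  have h := (ContinuousLinearMap.mul ℂ A a).intervalIntegral_comp_comm hf.out
  simpa [circleIntegral] using h.symm

theorem circleIntegral_mul [CompleteSpace A] (a : A) {f : ℂ → A} {c : ℂ} {r : ℝ}
    (hf : CircleIntegrable f c r) : (∮ z in C(c, r), f z) * a = ∮ z in C(c, r), f z * a := by
  have h := ((ContinuousLinearMap.mul ℂ A).flip a).intervalIntegral_comp_comm hf.out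
  simpa [circleIntegral] using h.symm

theorem mul_resolvent {a : A} {z : ℂ} (hz : z ∈ resolventSet ℂ a) :
    a * resolvent a z = z • resolvent a z - 1 := by
  have h : (algebraMap ℂ A z - a) * resolvent a z = 1 := Ring.mul_inverse_cancel _ hz
  rw [sub_mul, ← Algebra.smul_def] at h
  rw [← h]; abel

theorem commute_resolvent (a : A) (z : ℂ) : Commute a (resolvent a z) := by
  have h : Commute a (algebraMap ℂ A z - a) :=
    Commute.sub_right (Algebra.commutes z a).symm (Commute.refl a)
  by_cases hu : IsUnit (algebraMap ℂ A z - a)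
  · obtain ⟨u, hu⟩ := hu
    rw [← hu] at h
    rw [resolvent, ← hu, Ring.inverse_unit]
    exact h.units_inv_right
  · rw [resolvent, Ring.inverse_non_unit _ hu]
    exact Commute.zero_right a

theorem norm_laurentCoeff_le {a : A} {r M : ℝ} (hr : 0 < r)
    (hM : ∀ z ∈ Metric.sphere (0 : ℂ) r, ‖resolvent a z‖ ≤ M) (n : ℤ) :
    ‖laurentCoeff a r n‖ ≤ r * (r ^ n * M) := by
  refine circleIntegral.norm_two_pi_i_inv_smul_integral_le_of_norm_le_const hr.le fun z hz => ?_
  rw [norm_smul, norm_zpow, mem_sphere_zero_iff_norm.1 hz]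
  exact mul_le_mul_of_nonneg_left (hM z hz) (zpow_nonneg hr.le n)

variable [CompleteSpace A]

theorem continuousOn_zpow_smul_resolvent (a : A) (n : ℤ) :
    ContinuousOn (fun z : ℂ => z ^ n • resolvent a z) ({0}ᶜ ∩ resolventSet ℂ a) := by
  refine ContinuousOn.smul (fun z hz => ?_) (fun z hz => ?_)
  · exact (continuousAt_zpow₀ z n (Or.inl hz.1)).continuousWithinAt
  · exact (spectrum.hasDerivAt_resolvent_const_left hz.2).continuousAt.continuousWithinAt

theorem circleIntegrable_zpow_smul_resolvent {a : A} {r : ℝ} (hr : 0 < r)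
    (h : Metric.sphere 0 r ⊆ resolventSet ℂ a) (n : ℤ) :
    CircleIntegrable (fun z : ℂ => z ^ n • resolvent a z) 0 r := by
  refine ContinuousOn.circleIntegrable hr.le ((continuousOn_zpow_smul_resolvent a n).mono ?_)
  exact fun z hz => ⟨ne_zero_of_mem_sphere hr.ne' ⟨z, hz⟩, h hz⟩

theorem laurentCoeff_succ {a : A} {r : ℝ} (hr : 0 < r)
    (h : Metric.sphere 0 r ⊆ resolventSet ℂ a) (n : ℤ) :
    laurentCoeff a r (n + 1) = a * laurentCoeff a r n + if n = -1 then 1 else 0 := by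
  have hz0 : ∀ z ∈ Metric.sphere (0 : ℂ) r, z ≠ 0 :=
    fun z hz => ne_zero_of_mem_sphere hr.ne' ⟨z, hz⟩
  have hint : ∀ m : ℤ, CircleIntegrable (fun z : ℂ => z ^ m • resolvent a z) 0 r :=
    circleIntegrable_zpow_smul_resolvent hr h
  have hone : CircleIntegrable (fun z : ℂ => z ^ n • (1 : A)) 0 r := by
    refine ContinuousOn.circleIntegrable hr.le (ContinuousOn.smul (fun z hz => ?_)
      continuousOn_const)
    exact (continuousAt_zpow₀ z n (Or.inl (hz0 z hz))).continuousWithinAt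
  have h1 : (∮ z in C(0, r), a * (z ^ n • resolvent a z)) =
      (∮ z in C(0, r), z ^ (n + 1) • resolvent a z) - ∮ z in C(0, r), z ^ n • (1 : A) := by
    rw [← circleIntegral.integral_sub (hint _) hone]
    refine circleIntegral.integral_congr hr.le fun z hz => ?_
    simp only [mul_smul_comm, mul_resolvent (h hz), smul_sub, smul_smul, zpow_add_one₀ (hz0 z hz)]
  have h2 : (2 * Real.pi * Complex.I : ℂ)⁻¹ • (∮ z in C(0, r), z ^ n • (1 : A)) =
      if n = -1 then 1 else 0 := by
    rw [circleIntegral.integral_smul_const]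
    split_ifs with hn
    · have := circleIntegral.integral_sub_center_inv 0 hr.ne'
      simp only [sub_zero] at this
      simp only [hn, zpow_neg_one, this, smul_smul]
      rw [inv_mul_cancel₀ Complex.two_pi_I_ne_zero, one_smul]
    · have := circleIntegral.integral_sub_zpow_of_ne hn 0 0 r
      simp only [sub_zero] at this
      simp [this]
  rw [← h2, laurentCoeff, laurentCoeff, mul_smul_comm, mul_circleIntegral a (hint n), h1, smul_sub,
    sub_add_cancel]

theorem commute_laurentCoeff {a : A} {r : ℝ} (hr : 0 < r)
    (h : Metric.sphere 0 r ⊆ resolventSet ℂ a) (n : ℤ) : Commute a (laurentCoeff a r n) := by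
  have hint := circleIntegrable_zpow_smul_resolvent hr h n
  rw [Commute, SemiconjBy, laurentCoeff, mul_smul_comm, smul_mul_assoc, mul_circleIntegral a hint,
    circleIntegral_mul a hint]
  simp only [mul_smul_comm, smul_mul_assoc, (commute_resolvent a _).eq]

theorem laurentCoeff_eq_of_annulus {a : A} {r R : ℝ} (hr : 0 < r) (hrR : r ≤ R)
    (h : Metric.closedBall 0 R \ Metric.ball 0 r ⊆ resolventSet ℂ a) (n : ℤ) :
    laurentCoeff a R n = laurentCoeff a r n := by
  have hz0 : ∀ z : ℂ, z ∉ Metric.ball (0 : ℂ) r → z ≠ 0 := by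
    rintro z hz rfl
    exact hz (Metric.mem_ball_self hr)
  rw [laurentCoeff, laurentCoeff,
    Complex.circleIntegral_eq_of_differentiable_on_annulus_off_countable hr hrR
      Set.countable_empty
      ((continuousOn_zpow_smul_resolvent a n).mono fun z hz => ⟨hz0 z hz.2, h hz⟩)]
  rintro z ⟨⟨hzR, hzr⟩, -⟩
  have hzr' : z ∉ Metric.ball (0 : ℂ) r := fun hz => hzr (Metric.ball_subset_closedBall hz)
  have h1 : DifferentiableAt ℂ (fun w : ℂ => w ^ n) z :=
    differentiableAt_zpow.2 (Or.inl (hz0 z hzr'))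
  exact h1.smul (spectrum.hasDerivAt_resolvent_const_left
    (h ⟨Metric.ball_subset_closedBall hzR, hzr'⟩)).differentiableAt

/-- If the spectrum misses the unit circle, the resolvent set contains a closed annulus around
it. -/
theorem exists_annulus_subset_resolventSet {a : A}
    (h : spectrum ℂ a ∩ {z : ℂ | ‖z‖ = 1} = ∅) :
    ∃ r R : ℝ, 0 < r ∧ r < 1 ∧ 1 < R ∧
      Metric.closedBall 0 R \ Metric.ball 0 r ⊆ resolventSet ℂ a := by
  have hsub : Metric.sphere (0 : ℂ) 1 ⊆ resolventSet ℂ a := by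
    intro z hz
    by_contra hcon
    have : z ∈ spectrum ℂ a ∩ {z : ℂ | ‖z‖ = 1} := ⟨hcon, by simpa using hz⟩
    simp [h] at this
  obtain ⟨δ, hδ, hδsub⟩ := (isCompact_sphere (0 : ℂ) 1).exists_cthickening_subset_open
    (spectrum.isOpen_resolventSet a) hsub
  refine ⟨1 - min δ (1 / 2), 1 + min δ (1 / 2), ?_, ?_, ?_, fun z hz => hδsub ?_⟩
  · linarith [min_le_right δ (1 / 2)]
  · linarith [lt_min hδ (by norm_num : (0 : ℝ) < 1 / 2)]
  · linarith [lt_min hδ (by norm_num : (0 : ℝ) < 1 / 2)]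
  · have h1 : ‖z‖ ≤ 1 + min δ (1 / 2) := by simpa using hz.1
    have h2 : 1 - min δ (1 / 2) ≤ ‖z‖ := by simpa using hz.2
    have hz0 : 0 < ‖z‖ := by linarith [min_le_right δ (1 / 2)]
    -- the radial projection of `z` to the unit circle is at distance `|‖z‖ - 1|`
    refine Metric.mem_cthickening_of_dist_le z ((‖z‖⁻¹ : ℝ) • z) δ _ ?_ ?_
    · simp [hz0.ne']
    · have h3 : z - (‖z‖⁻¹ : ℝ) • z = (1 - ‖z‖⁻¹ : ℝ) • z := by rw [sub_smul, one_smul]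
      rw [dist_eq_norm, h3, norm_smul, Real.norm_eq_abs, ← abs_of_pos hz0, ← abs_mul,
        abs_of_pos hz0, sub_mul, one_mul, inv_mul_cancel₀ hz0.ne', abs_le]
      constructor <;> linarith [min_le_left δ (1 / 2)]

/-- The Riesz projection `p` of an invertible element whose spectrum misses the unit circle: the
positive powers of `a` decay exponentially on `p`, the negative ones on `1 - p`. -/
theorem exists_riesz_projection (a : Aˣ) (h : spectrum ℂ (a : A) ∩ {z : ℂ | ‖z‖ = 1} = ∅) :
    ∃ (p : A) (K β : ℝ), 0 < β ∧ β < 1 ∧ Commute (a : A) p ∧ ∀ n : ℕ,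
      ‖((a ^ (n : ℤ) : Aˣ) : A) * p‖ ≤ K * β ^ n ∧
      ‖((a ^ (-(n : ℤ)) : Aˣ) : A) * (1 - p)‖ ≤ K * β ^ n := by
  obtain ⟨r, R, hr, hr1, hR1, hsub⟩ := exists_annulus_subset_resolventSet h
  have hR : 0 < R := by linarith
  have hrR : r ≤ R := by linarith
  have hcomp : IsCompact (Metric.closedBall (0 : ℂ) R \ Metric.ball 0 r) :=
    (isCompact_closedBall 0 R).diff Metric.isOpen_ball
  obtain ⟨M, hM⟩ := hcomp.exists_bound_of_continuousOn (f := resolvent (a : A)) fun z hz =>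
    (spectrum.hasDerivAt_resolvent_const_left (hsub hz)).continuousAt.continuousWithinAt
  have hsr : Metric.sphere (0 : ℂ) r ⊆ Metric.closedBall 0 R \ Metric.ball 0 r := fun z hz => by
    have : ‖z‖ = r := by simpa using hz
    simp [this, hrR]
  have hsR : Metric.sphere (0 : ℂ) R ⊆ Metric.closedBall 0 R \ Metric.ball 0 r := fun z hz => by
    have : ‖z‖ = R := by simpa using hz
    simp [this, hrR]
  have hM0 : 0 ≤ M := (norm_nonneg _).trans (hM R (hsR (by simp [hR.le])))
  set G : ℤ → A := laurentCoeff (a : A) r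
  have hG : ∀ n, G (n + 1) = a * G n + if n = -1 then 1 else 0 :=
    laurentCoeff_succ hr (hsr.trans hsub)
  have hpos : ∀ n : ℕ, ((a ^ (n : ℤ) : Aˣ) : A) * G 0 = G n := by
    intro n
    induction n with
    | zero => simp
    | succ k ih =>
      have hk : (k : ℤ) ≠ -1 := by omega
      rw [Nat.cast_succ, hG, if_neg hk, add_zero, ← ih, ← mul_assoc, add_comm, zpow_one_add,
        Units.val_mul]
  have hneg : ∀ n : ℕ, ((a ^ (-(n : ℤ)) : Aˣ) : A) * (1 - G 0) =
      (if n = 0 then 1 else 0) - G (-n) := by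
    intro n
    induction n with
    | zero => simp
    | succ k ih =>
      have h1 : (a ^ (-((k + 1 : ℕ) : ℤ)) : Aˣ) = a⁻¹ * a ^ (-(k : ℤ)) := by
        rw [← zpow_neg_one, ← zpow_add]; congr 1; push_cast; ring
      have h2 := hG (-((k + 1 : ℕ) : ℤ))
      have h3 : -((k + 1 : ℕ) : ℤ) + 1 = -(k : ℤ) := by push_cast; ring
      have h4 : -((k + 1 : ℕ) : ℤ) = -1 ↔ k = 0 := by omega
      simp only [h3, h4] at h2
      rw [h1, Units.val_mul, mul_assoc, ih, h2]
      simp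
  have hbneg : ∀ n : ℕ, ‖G (-n)‖ ≤ R * M * (R⁻¹) ^ n := by
    intro n
    have := norm_laurentCoeff_le hR (fun z hz => hM z (hsR hz)) (-(n : ℤ))
    rw [laurentCoeff_eq_of_annulus hr hrR hsub] at this
    refine this.trans_eq ?_
    rw [zpow_neg, zpow_natCast, inv_pow]; ring
  have hbpos : ∀ n : ℕ, ‖G n‖ ≤ r * M * r ^ n := by
    intro n
    refine (norm_laurentCoeff_le hr (fun z hz => hM z (hsr hz)) (n : ℤ)).trans_eq ?_
    rw [zpow_natCast]; ring
  have hRi : 0 < R⁻¹ := inv_pos.2 hR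
  have hβ0 : 0 < max r R⁻¹ := lt_max_of_lt_left hr
  refine ⟨G 0, R * M + ‖(1 : A)‖, max r R⁻¹, hβ0, max_lt hr1 (inv_lt_one_of_one_lt₀ hR1),
    commute_laurentCoeff hr (hsr.trans hsub) 0, fun n => ⟨?_, ?_⟩⟩
  · rw [hpos]
    refine (hbpos n).trans ?_
    have h1 : r ^ n ≤ (max r R⁻¹) ^ n := pow_le_pow_left₀ hr.le (le_max_left _ _) n
    have h2 : r * M ≤ R * M + ‖(1 : A)‖ := by nlinarith [norm_nonneg (1 : A)]
    exact mul_le_mul h2 h1 (by positivity) (by positivity)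
  · rw [hneg]
    have h1 : (R⁻¹) ^ n ≤ (max r R⁻¹) ^ n := pow_le_pow_left₀ hRi.le (le_max_right _ _) n
    have h2 : ‖(if n = 0 then 1 else 0 : A)‖ ≤ ‖(1 : A)‖ * (max r R⁻¹) ^ n := by
      split_ifs with h0
      · simp [h0]
      · simp only [norm_zero]; positivity
    have h3 : ‖G (-n)‖ ≤ R * M * (max r R⁻¹) ^ n :=
      (hbneg n).trans (mul_le_mul_of_nonneg_left h1 (by positivity))
    refine (norm_sub_le _ _).trans ?_
    linarith

end Laurent

/-! ### Iterates of continuous linear equivalences -/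

section Iterates

variable {𝕜 𝕜' X Y : Type*} [NontriviallyNormedField 𝕜] [NontriviallyNormedField 𝕜']
  [NormedAddCommGroup X] [NormedSpace 𝕜 X] [NormedAddCommGroup Y] [NormedSpace 𝕜' Y]

theorem toHomeomorph_zpow_apply (T : X ≃L[𝕜] X) (n : ℤ) (x : X) :
    (T.toHomeomorph ^ n) x = (T ^ n) x := by
  let φ : (X ≃L[𝕜] X) →* (X ≃ₜ X) :=
    { toFun := fun S => S.toHomeomorph, map_one' := rfl, map_mul' := fun _ _ => rfl }
  exact congrArg (fun S : X ≃ₜ X => S x) (map_zpow φ T n).symm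

theorem dist_toHomeomorph_zpow (T : X ≃L[𝕜] X) (n : ℤ) (x y : X) :
    dist ((T.toHomeomorph ^ n) x) ((T.toHomeomorph ^ n) y) = ‖(T ^ n) (x - y)‖ := by
  rw [toHomeomorph_zpow_apply, toHomeomorph_zpow_apply, dist_eq_norm, map_sub]

theorem zpow_add_apply (T : X ≃L[𝕜] X) (m n : ℤ) (x : X) :
    (T ^ (m + n)) x = (T ^ m) ((T ^ n) x) := by
  rw [zpow_add]; rfl

theorem zpow_neg_zpow_apply (T : X ≃L[𝕜] X) (n : ℤ) (x : X) : (T ^ (-n)) ((T ^ n) x) = x := by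
  rw [← zpow_add_apply, neg_add_cancel]; rfl

theorem zpow_zpow_neg_apply (T : X ≃L[𝕜] X) (n : ℤ) (x : X) : (T ^ n) ((T ^ (-n)) x) = x := by
  rw [← zpow_add_apply, add_neg_cancel]; rfl

theorem zpow_add_one_apply (T : X ≃L[𝕜] X) (n : ℤ) (x : X) :
    (T ^ (n + 1)) x = T ((T ^ n) x) := by
  rw [add_comm, zpow_add_apply, zpow_one]

/-- A two-sided sequence satisfying `w (n + 1) = T (w n)` is an orbit of `T`. -/
theorem eq_zpow_apply_of_succ (T : X ≃L[𝕜] X) {w : ℤ → X} (hw : ∀ n, w (n + 1) = T (w n))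
    (n : ℤ) : w n = (T ^ n) (w 0) := by
  induction n using Int.induction_on with
  | zero => rfl
  | succ k ih => rw [hw, ih, zpow_add_one_apply]
  | pred k ih =>
    apply T.injective
    rw [← hw, ← zpow_add_one_apply, sub_add_cancel, ih]

theorem map_zpow_apply_of_semiconj {S : Y ≃L[𝕜'] Y} {T : X ≃L[𝕜] X} {f : Y → X}
    (hf : ∀ y, f (S y) = T (f y)) (n : ℤ) (y : Y) : f ((S ^ n) y) = (T ^ n) (f y) :=
  eq_zpow_apply_of_succ T (w := fun n => f ((S ^ n) y))
    (fun n => by rw [zpow_add_one_apply, hf]) n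

/-- The recursion `x (n + 1) = T (x n) + z n` has a solution on all of `ℤ`, since `T` is
invertible. -/
theorem exists_solution (T : X ≃L[𝕜] X) (z : ℤ → X) :
    ∃ x : ℤ → X, ∀ n, x (n + 1) = T (x n) + z n := by
  let a : ℕ → X := fun n => Nat.rec 0 (fun k v => T v + z k) n
  let b : ℕ → X := fun n => Nat.rec 0 (fun k v => T.symm (v - z (-((k : ℤ) + 1)))) n
  have hb : ∀ k : ℕ, b k = T (b (k + 1)) + z (-((k : ℤ) + 1)) := fun k => by
    change b k = T (T.symm (b k - z (-((k : ℤ) + 1)))) + z (-((k : ℤ) + 1))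
    rw [T.apply_symm_apply, sub_add_cancel]
  refine ⟨fun n => Int.rec a (fun k => b (k + 1)) n, fun n => ?_⟩
  rcases n with k | k
  · rfl
  · rcases k with _ | k
    · exact hb 0
    · have h1 : Int.negSucc (k + 1) + 1 = Int.negSucc k := rfl
      have h2 : Int.negSucc (k + 1) = -(((k + 1 : ℕ) : ℤ) + 1) := rfl
      have h3 : b (k + 1) = T (b (k + 1 + 1)) + z (Int.negSucc (k + 1)) := by
        rw [h2]; exact hb (k + 1)
      rw [h1]
      exact h3

end Iterates

/-! ### Exponential dichotomies -/

section Dichotomy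

variable {X : Type*} [NormedAddCommGroup X] [NormedSpace ℝ X]

/-- `P` commutes with `T`, the iterates of `T` decay exponentially on the range of `P`, and those
of `T⁻¹` on the range of `1 - P`. These conditions force `P` to be idempotent, so this need not be
demanded. -/
structure IsDichotomy (T : X ≃L[ℝ] X) (P : X →L[ℝ] X) (K β : ℝ) : Prop where
  one_le : 1 ≤ K
  pos : 0 < β
  lt_one : β < 1
  comm : ∀ x, P (T x) = T (P x)
  forward : ∀ (n : ℕ) (x : X), ‖(T ^ (n : ℤ)) (P x)‖ ≤ K * β ^ n * ‖x‖
  backward : ∀ (n : ℕ) (x : X), ‖(T ^ (-(n : ℤ))) (x - P x)‖ ≤ K * β ^ n * ‖x‖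

theorem tendsto_const_mul_pow_mul {β : ℝ} (h0 : 0 < β) (h1 : β < 1) (K M : ℝ) :
    Filter.Tendsto (fun n : ℕ => K * β ^ n * M) Filter.atTop (nhds 0) := by
  have := ((tendsto_pow_atTop_nhds_zero_of_lt_one h0.le h1).const_mul K).mul_const M
  simpa using this

namespace IsDichotomy

variable {T : X ≃L[ℝ] X} {P : X →L[ℝ] X} {K β : ℝ}

theorem comm_zpow (h : IsDichotomy T P K β) (n : ℤ) (x : X) : P ((T ^ n) x) = (T ^ n) (P x) :=
  map_zpow_apply_of_semiconj h.comm n x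

theorem apply_eq_self (h : IsDichotomy T P K β) {v : X} {M : ℝ}
    (hv : ∀ n : ℕ, ‖(T ^ (n : ℤ)) v‖ ≤ M) : P v = v := by
  have h1 : ∀ n : ℕ, ‖v - P v‖ ≤ K * β ^ n * M := fun n => by
    have h2 := h.backward n ((T ^ (n : ℤ)) v)
    rw [h.comm_zpow, ← map_sub, zpow_neg_zpow_apply] at h2
    have := h.one_le
    have := h.pos
    exact h2.trans (mul_le_mul_of_nonneg_left (hv n) (by positivity))
  have h3 := ge_of_tendsto' (tendsto_const_mul_pow_mul h.pos h.lt_one K M) h1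
  exact (sub_eq_zero.1 (norm_le_zero_iff.1 h3)).symm

theorem apply_eq_zero (h : IsDichotomy T P K β) {v : X} {M : ℝ}
    (hv : ∀ n : ℕ, ‖(T ^ (-(n : ℤ))) v‖ ≤ M) : P v = 0 := by
  have h1 : ∀ n : ℕ, ‖P v‖ ≤ K * β ^ n * M := fun n => by
    have h2 := h.forward n ((T ^ (-(n : ℤ))) v)
    rw [h.comm_zpow, zpow_zpow_neg_apply] at h2
    have := h.one_le
    have := h.pos
    exact h2.trans (mul_le_mul_of_nonneg_left (hv n) (by positivity))
  exact norm_le_zero_iff.1 (ge_of_tendsto' (tendsto_const_mul_pow_mul h.pos h.lt_one K M) h1)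

theorem mul_pow_le (h : IsDichotomy T P K β) (n : ℕ) : K * β ^ n ≤ K :=
  mul_le_of_le_one_right (zero_le_one.trans h.one_le) (pow_le_one₀ h.pos.le h.lt_one.le)

theorem hasHyperbolicCoordinates (h : IsDichotomy T P K β) :
    HasHyperbolicCoordinates T.toHomeomorph := by
  have hK : 0 < K := zero_lt_one.trans_le h.one_le
  refine ⟨fun ε hε => ⟨ε / K, by positivity, fun x y hxy => ?_⟩,
    K, β, 1, h.one_le, h.pos, h.lt_one, one_pos, fun x => ⟨fun y hy n => ?_, fun y hy n => ?_⟩⟩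
  · have hb : ∀ n : ℕ, K * β ^ n * ‖x - y‖ ≤ ε := fun n => by
      calc K * β ^ n * ‖x - y‖ ≤ K * (ε / K) :=
            mul_le_mul (h.mul_pow_le n) (by rwa [← dist_eq_norm]) (norm_nonneg _) hK.le
        _ = ε := by field_simp
    refine ⟨x - P (x - y), fun n => ?_, fun n => ?_⟩
    · rw [dist_toHomeomorph_zpow, sub_sub_cancel]
      exact (h.forward n _).trans (hb n)
    · rw [dist_toHomeomorph_zpow, show y - (x - P (x - y)) = -((x - y) - P (x - y)) by abel,
        map_neg, norm_neg]
      exact (h.backward n _).trans (hb n)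
  · have hv : P (x - y) = x - y :=
      h.apply_eq_self fun k => (dist_toHomeomorph_zpow T k x y).symm.trans_le (hy k)
    have := h.forward n (x - y)
    rwa [hv, ← dist_toHomeomorph_zpow, ← dist_eq_norm] at this
  · have hv : P (x - y) = 0 :=
      h.apply_eq_zero fun k => (dist_toHomeomorph_zpow T _ x y).symm.trans_le (hy k)
    have := h.backward n (x - y)
    rwa [hv, sub_zero, ← dist_toHomeomorph_zpow, ← dist_eq_norm] at this

theorem isExpansive (h : IsDichotomy T P K β) : IsExpansive T.toHomeomorph := by
  refine ⟨1, one_pos, fun x y hxy => ?_⟩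
  by_contra! hcon
  refine hxy (sub_eq_zero.1 ?_)
  have hb : ∀ n : ℤ, ‖(T ^ n) (x - y)‖ ≤ 1 := fun n => by
    rw [← dist_toHomeomorph_zpow]; exact (hcon n).le
  rw [← h.apply_eq_self fun n => hb n, h.apply_eq_zero fun n => hb _]

/-- With an exponential dichotomy, the equation `y (n + 1) = T (y n) + z n` is solved by
convolving `z` with the Green's function given by `T ^ k P` for `k ≥ 0` and by `-T ^ k (1 - P)`
for `k < 0`. -/
theorem exists_bounded_solution [CompleteSpace X] (h : IsDichotomy T P K β) {z : ℤ → X} {C : ℝ}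
    (hz : ∀ n, ‖z n‖ ≤ C) :
    ∃ y : ℤ → X, (∀ n, ‖y n‖ ≤ 2 * (K * (1 - β)⁻¹) * C) ∧ ∀ n, y (n + 1) = T (y n) + z n := by
  have hK : 0 < K := zero_lt_one.trans_le h.one_le
  have hβ := h.pos
  have hC : 0 ≤ C := (norm_nonneg _).trans (hz 0)
  let f : ℤ → ℕ → X := fun n k => (T ^ (k : ℤ)) (P (z (n - k)))
  let g : ℤ → ℕ → X := fun n k => (T ^ (-((k + 1 : ℕ) : ℤ))) (z (n + k) - P (z (n + k)))
  have hgeom : HasSum (fun k : ℕ => K * C * β ^ k) (K * C * (1 - β)⁻¹) :=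
    (hasSum_geometric_of_lt_one h.pos.le h.lt_one).mul_left _
  have hf : ∀ n k, ‖f n k‖ ≤ K * C * β ^ k := fun n k =>
    calc ‖f n k‖ ≤ K * β ^ k * ‖z (n - k)‖ := h.forward k _
      _ ≤ K * β ^ k * C := mul_le_mul_of_nonneg_left (hz _) (by positivity)
      _ = K * C * β ^ k := by ring
  have hg : ∀ n k, ‖g n k‖ ≤ K * C * β ^ k := fun n k =>
    calc ‖g n k‖ ≤ K * β ^ (k + 1) * ‖z (n + k)‖ := h.backward (k + 1) _
      _ ≤ K * β ^ (k + 1) * C := mul_le_mul_of_nonneg_left (hz _) (by positivity)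
      _ = K * C * β ^ k * β := by ring
      _ ≤ K * C * β ^ k := mul_le_of_le_one_right (by positivity) h.lt_one.le
  have hfs : ∀ n, Summable (f n) := fun n => Summable.of_norm_bounded hgeom.summable (hf n)
  have hgs : ∀ n, Summable (g n) := fun n => Summable.of_norm_bounded hgeom.summable (hg n)
  have hf1 : ∀ n, ∑' k, f n k = P (z n) + T (∑' k, f (n - 1) k) := fun n => by
    rw [(hfs n).tsum_eq_zero_add, T.map_tsum]
    congr 1
    · simp only [f, Nat.cast_zero, sub_zero]; rfl
    · refine tsum_congr fun k => ?_
      simp only [f]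
      rw [Nat.cast_succ, zpow_add_one_apply, show n - ((k : ℤ) + 1) = n - 1 - k by ring]
  have hTg : ∀ n k, T (g n k) = (T ^ (-(k : ℤ))) (z (n + k) - P (z (n + k))) := fun n k => by
    simp only [g]
    rw [← zpow_add_one_apply, Nat.cast_succ, neg_add_rev, neg_add_cancel_comm]
  have hg1 : ∀ n, T (∑' k, g n k) = (z n - P (z n)) + ∑' k, g (n + 1) k := fun n => by
    rw [T.map_tsum, tsum_congr (hTg n), Summable.tsum_eq_zero_add]
    · congr 1
      · simp only [Nat.cast_zero, neg_zero, add_zero]; rfl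
      · refine tsum_congr fun k => ?_
        simp only [g]
        rw [Nat.cast_succ, show n + ((k : ℤ) + 1) = n + 1 + k by ring]
    · exact (T.summable.2 (hgs n)).congr (hTg n)
  refine ⟨fun n => ∑' k, f (n - 1) k - ∑' k, g n k, fun n => ?_, fun n => ?_⟩
  · calc ‖∑' k, f (n - 1) k - ∑' k, g n k‖ ≤ K * C * (1 - β)⁻¹ + K * C * (1 - β)⁻¹ :=
          (norm_sub_le _ _).trans (add_le_add (tsum_of_norm_bounded hgeom (hf _))
            (tsum_of_norm_bounded hgeom (hg _)))
      _ = 2 * (K * (1 - β)⁻¹) * C := by ring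
  · simp only [map_sub, hg1, add_sub_cancel_right, hf1 n]
    abel

theorem hasShadowing [CompleteSpace X] (h : IsDichotomy T P K β) :
    HasShadowing T.toHomeomorph := by
  intro ε hε
  have hB : 0 < 2 * (K * (1 - β)⁻¹) :=
    mul_pos two_pos (mul_pos (zero_lt_one.trans_le h.one_le) (inv_pos.2 (sub_pos.2 h.lt_one)))
  refine ⟨ε / 2 / (2 * (K * (1 - β)⁻¹)), by positivity, fun x hx => ?_⟩
  obtain ⟨y, hy, hrec⟩ := h.exists_bounded_solution (z := fun n => x (n + 1) - T (x n))
    (C := ε / 2 / (2 * (K * (1 - β)⁻¹))) fun n => by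
      rw [← dist_eq_norm, dist_comm]; exact hx n
  have horb : ∀ n, x n - y n = (T ^ n) (x 0 - y 0) :=
    eq_zpow_apply_of_succ T (w := fun n => x n - y n) fun n => by
      simp only [hrec, map_sub]; abel
  refine ⟨x 0 - y 0, fun n => ?_⟩
  rw [toHomeomorph_zpow_apply, ← horb, dist_eq_norm, sub_sub_cancel]
  refine (hy n).trans_lt ?_
  rw [mul_div_cancel₀ _ hB.ne']
  linarith

end IsDichotomy

/-! ### Hyperbolic coordinates yield a dichotomy -/

/-- The vectors whose images under a sequence of linear equivalences are bounded. -/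
def boundedVectors (σ : ℕ → X ≃L[ℝ] X) : Submodule ℝ X where
  carrier := {v | ∃ M : ℝ, ∀ n, ‖σ n v‖ ≤ M}
  add_mem' := by
    rintro v w ⟨M, hM⟩ ⟨N, hN⟩
    exact ⟨M + N, fun n => by
      rw [map_add]; exact (norm_add_le _ _).trans (add_le_add (hM n) (hN n))⟩
  zero_mem' := ⟨0, fun n => by simp⟩
  smul_mem' := by
    rintro t v ⟨M, hM⟩
    exact ⟨‖t‖ * M, fun n => by
      rw [map_smul, norm_smul]; exact mul_le_mul_of_nonneg_left (hM n) (norm_nonneg t)⟩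

theorem apply_mem_boundedVectors {σ : ℕ → X ≃L[ℝ] X} {S : X ≃L[ℝ] X}
    (hS : ∀ n v, σ n (S v) = S (σ n v)) {v : X} (hv : v ∈ boundedVectors σ) :
    S v ∈ boundedVectors σ := by
  obtain ⟨M, hM⟩ := hv
  refine ⟨‖(S : X →L[ℝ] X)‖ * M, fun n => ?_⟩
  rw [hS]
  exact ((S : X →L[ℝ] X).le_opNorm _).trans (mul_le_mul_of_nonneg_left (hM n) (norm_nonneg _))

/-- By homogeneity, a decay estimate for vectors with images bounded by `γ` holds for all vectors
with bounded images. -/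
theorem norm_le_of_mem_boundedVectors {σ : ℕ → X ≃L[ℝ] X} {a : ℕ → ℝ} {γ : ℝ} (hγ : 0 < γ)
    (h : ∀ v, (∀ n, ‖σ n v‖ ≤ γ) → ∀ n, ‖σ n v‖ ≤ a n * ‖v‖) {v : X}
    (hv : v ∈ boundedVectors σ) (n : ℕ) : ‖σ n v‖ ≤ a n * ‖v‖ := by
  obtain ⟨M, hM⟩ := hv
  have hM1 : 0 < max M 1 := lt_max_of_lt_right one_pos
  have ht : 0 < γ / max M 1 := by positivity
  have hn : ∀ w : X, ‖(γ / max M 1) • w‖ = γ / max M 1 * ‖w‖ := fun w => by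
    rw [norm_smul, Real.norm_of_nonneg ht.le]
  have h1 := h ((γ / max M 1) • v) (fun k => by
    rw [map_smul, hn]
    calc γ / max M 1 * ‖σ k v‖ ≤ γ / max M 1 * max M 1 :=
          mul_le_mul_of_nonneg_left ((hM k).trans (le_max_left _ _)) ht.le
      _ = γ := by field_simp) n
  rw [map_smul, hn, hn, mul_left_comm] at h1
  exact le_of_mul_le_mul_left h1 ht

theorem exists_isDichotomy_of_hasHyperbolicCoordinates {T : X ≃L[ℝ] X}
    (h : HasHyperbolicCoordinates T.toHomeomorph) : ∃ P K β, IsDichotomy T P K β := by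
  obtain ⟨hcan, c, β, γ, hc, hβ0, hβ1, hγ, hcoord⟩ := h
  let σ : ℕ → X ≃L[ℝ] X := fun n => T ^ (n : ℤ)
  let τ : ℕ → X ≃L[ℝ] X := fun n => T ^ (-(n : ℤ))
  have hs : ∀ v ∈ boundedVectors σ, ∀ n : ℕ, ‖σ n v‖ ≤ c * β ^ n * ‖v‖ := fun v hv n => by
    refine norm_le_of_mem_boundedVectors (a := fun n => c * β ^ n) hγ (fun w hw k => ?_) hv n
    have := (hcoord w).1 0 (fun m => by rw [dist_toHomeomorph_zpow, sub_zero]; exact hw m) k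
    rwa [dist_toHomeomorph_zpow, sub_zero, dist_zero_right] at this
  have hu : ∀ v ∈ boundedVectors τ, ∀ n : ℕ, ‖τ n v‖ ≤ c * β ^ n * ‖v‖ := fun v hv n => by
    refine norm_le_of_mem_boundedVectors (a := fun n => c * β ^ n) hγ (fun w hw k => ?_) hv n
    have := (hcoord w).2 0 (fun m => by rw [dist_toHomeomorph_zpow, sub_zero]; exact hw m) k
    rwa [dist_toHomeomorph_zpow, sub_zero, dist_zero_right] at this
  have hcomm : ∀ (m n : ℤ) (v : X), (T ^ m) ((T ^ n) v) = (T ^ n) ((T ^ m) v) := fun m n v => by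
    rw [← zpow_add_apply, add_comm, zpow_add_apply]
  have hcomm1 : ∀ (m : ℤ) (v : X), (T ^ m) (T v) = T ((T ^ m) v) := fun m v => by
    simpa using hcomm m 1 v
  -- a vector with bounded two-sided orbit vanishes: going back `n` steps and forth again
  -- contracts it by `(c β ^ n) ^ 2`
  have hzero : ∀ v ∈ boundedVectors σ, v ∈ boundedVectors τ → v = 0 := fun v hvs hvu => by
    have h1 : ∀ n : ℕ, ‖v‖ ≤ c * β ^ n * (c * ‖v‖) := fun n => by
      have hmem : τ n v ∈ boundedVectors σ := apply_mem_boundedVectors (fun k w => hcomm _ _ w) hvs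
      have h2 := hs _ hmem n
      rw [show σ n (τ n v) = v from zpow_zpow_neg_apply T n v] at h2
      refine h2.trans (mul_le_mul_of_nonneg_left ((hu v hvu n).trans ?_) (by positivity))
      exact mul_le_mul_of_nonneg_right (mul_le_of_le_one_right (by positivity)
        (pow_le_one₀ hβ0.le hβ1.le)) (norm_nonneg v)
    exact norm_le_zero_iff.1 (ge_of_tendsto' (tendsto_const_mul_pow_mul hβ0 hβ1 c (c * ‖v‖)) h1)
  obtain ⟨δ, hδ, hcan⟩ := hcan 1 one_pos
  have hdec : ∀ v : X, ∃ s : X, s ∈ boundedVectors σ ∧ v - s ∈ boundedVectors τ ∧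
      ‖s‖ ≤ δ⁻¹ * ‖v‖ ∧ ‖v - s‖ ≤ δ⁻¹ * ‖v‖ := fun v => by
    rcases eq_or_ne v 0 with rfl | hv
    · exact ⟨0, zero_mem _, by simp, by simp, by simp⟩
    have hv0 : 0 < ‖v‖ := norm_pos_iff.2 hv
    have ht : 0 < δ / ‖v‖ := by positivity
    have hti : ‖(δ / ‖v‖)⁻¹‖ = δ⁻¹ * ‖v‖ := by
      rw [Real.norm_of_nonneg (inv_nonneg.2 ht.le), inv_div, div_eq_inv_mul]
    obtain ⟨w, hws, hwu⟩ := hcan ((δ / ‖v‖) • v) 0 (by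
      rw [dist_zero_right, norm_smul, Real.norm_of_nonneg ht.le, div_mul_cancel₀ _ hv0.ne'])
    simp only [localStableSet, localUnstableSet, Set.mem_ofPred_eq, dist_toHomeomorph_zpow,
      zero_sub, map_neg, norm_neg] at hws hwu
    have e : v - (δ / ‖v‖)⁻¹ • ((δ / ‖v‖) • v - w) = (δ / ‖v‖)⁻¹ • w := by
      rw [smul_sub, smul_smul, inv_mul_cancel₀ ht.ne', one_smul, sub_sub_cancel]
    refine ⟨(δ / ‖v‖)⁻¹ • ((δ / ‖v‖) • v - w), Submodule.smul_mem _ _ ⟨1, hws⟩, ?_, ?_, ?_⟩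
    · rw [e]; exact Submodule.smul_mem _ _ ⟨1, hwu⟩
    · rw [norm_smul, hti]
      exact mul_le_of_le_one_right (by positivity) (hws 0)
    · rw [e, norm_smul, hti]
      exact mul_le_of_le_one_right (by positivity) (hwu 0)
  choose s hsσ hsτ hsn hsn' using hdec
  have huniq : ∀ v a : X, a ∈ boundedVectors σ → v - a ∈ boundedVectors τ → s v = a :=
    fun v a ha ha' => by
      refine sub_eq_zero.1 (hzero _ (sub_mem (hsσ v) ha) ?_)
      have := sub_mem ha' (hsτ v)
      rwa [sub_sub_sub_cancel_left] at this
  let P : X →L[ℝ] X := LinearMap.mkContinuous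
    { toFun := s
      map_add' := fun v w => huniq _ _ (add_mem (hsσ v) (hsσ w)) (by
        rw [add_sub_add_comm]; exact add_mem (hsτ v) (hsτ w))
      map_smul' := fun t v => huniq _ _ (Submodule.smul_mem _ t (hsσ v)) (by
        rw [RingHom.id_apply, ← smul_sub]; exact Submodule.smul_mem _ t (hsτ v)) } δ⁻¹ hsn
  have hδi : 0 < δ⁻¹ := inv_pos.2 hδ
  have hbound : ∀ (n : ℕ) (a v : X), ‖a‖ ≤ δ⁻¹ * ‖v‖ →
      c * β ^ n * ‖a‖ ≤ c * (δ⁻¹ + 1) * β ^ n * ‖v‖ := fun n a v ha =>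
    calc c * β ^ n * ‖a‖ ≤ c * β ^ n * (δ⁻¹ * ‖v‖ + ‖v‖) := by
          refine mul_le_mul_of_nonneg_left ?_ (by positivity)
          linarith [norm_nonneg v]
      _ = c * (δ⁻¹ + 1) * β ^ n * ‖v‖ := by ring
  refine ⟨P, c * (δ⁻¹ + 1), β, ?_, hβ0, hβ1, fun v => ?_, fun n v => ?_, fun n v => ?_⟩
  · nlinarith
  · refine huniq _ _ (apply_mem_boundedVectors (fun n w => hcomm1 _ w) (hsσ v)) ?_
    rw [← map_sub]
    exact apply_mem_boundedVectors (fun n w => hcomm1 _ w) (hsτ v)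
  · exact (hs _ (hsσ v) n).trans (hbound n _ v (hsn v))
  · exact (hu _ (hsτ v) n).trans (hbound n _ v (hsn' v))

end Dichotomy

/-! ### Bounded solutions of the inhomogeneous equation -/

section BoundedSolutions

/-- For every bounded two-sided sequence `z`, the equation `y (n + 1) = T (y n) + z n` has exactly
one bounded solution `y`. -/
def HasUniqueBoundedSolutions {X : Type*} [NormedAddCommGroup X] (T : X → X) : Prop :=
  ∀ z : ℤ → X, (∃ C : ℝ, ∀ n, ‖z n‖ ≤ C) →
    ∃! y : ℤ → X, (∃ C : ℝ, ∀ n, ‖y n‖ ≤ C) ∧ ∀ n, y (n + 1) = T (y n) + z n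

theorem hasUniqueBoundedSolutions_of_isExpansive_of_hasShadowing {X : Type*}
    [NormedAddCommGroup X] [NormedSpace ℝ X] {T : X ≃L[ℝ] X} (he : IsExpansive T.toHomeomorph)
    (hs : HasShadowing T.toHomeomorph) : HasUniqueBoundedSolutions T := by
  rintro z ⟨C, hC⟩
  obtain ⟨e, he0, he⟩ := he
  obtain ⟨δ, hδ, hs⟩ := hs 1 one_pos
  have hC1 : 0 < max C 1 := lt_max_of_lt_right one_pos
  have ht : 0 < δ / max C 1 := by positivity
  refine existsUnique_of_exists_of_unique ?_ ?_
  · obtain ⟨x, hx⟩ := exists_solution T fun n => (δ / max C 1) • z n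
    obtain ⟨y, hy⟩ := hs x fun n => by
      have e1 : x (n + 1) - T (x n) = (δ / max C 1) • z n := by rw [hx, add_sub_cancel_left]
      change dist (T (x n)) (x (n + 1)) ≤ δ
      rw [dist_comm, dist_eq_norm, e1, norm_smul, Real.norm_of_nonneg ht.le]
      calc δ / max C 1 * ‖z n‖ ≤ δ / max C 1 * max C 1 :=
            mul_le_mul_of_nonneg_left ((hC n).trans (le_max_left _ _)) ht.le
        _ = δ := by field_simp
    refine ⟨fun n => (δ / max C 1)⁻¹ • (x n - (T ^ n) y),
      ⟨‖(δ / max C 1)⁻¹‖ * 1, fun n => ?_⟩, fun n => ?_⟩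
    · rw [norm_smul]
      refine mul_le_mul_of_nonneg_left ?_ (norm_nonneg _)
      rw [← dist_eq_norm, ← toHomeomorph_zpow_apply]
      exact (hy n).le
    · have e2 : z n = (δ / max C 1)⁻¹ • (δ / max C 1) • z n := by
        rw [smul_smul, inv_mul_cancel₀ ht.ne', one_smul]
      beta_reduce
      rw [hx, zpow_add_one_apply, map_smul, map_sub]
      nth_rw 2 [e2]
      rw [← smul_add]
      congr 1
      abel
  · rintro y y' ⟨⟨M, hM⟩, hy⟩ ⟨⟨M', hM'⟩, hy'⟩
    have horb : ∀ n, y n - y' n = (T ^ n) (y 0 - y' 0) :=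
      eq_zpow_apply_of_succ T (w := fun n => y n - y' n) fun n => by
        simp only [hy, hy', map_sub]; abel
    have h0 : y 0 - y' 0 = 0 := by
      by_contra hne
      have hM0 : 0 ≤ M + M' :=
        add_nonneg ((norm_nonneg _).trans (hM 0)) ((norm_nonneg _).trans (hM' 0))
      have ht : 0 < e / (M + M' + 1) := by positivity
      obtain ⟨n, hn⟩ := he ((e / (M + M' + 1)) • (y 0 - y' 0)) 0 (smul_ne_zero ht.ne' hne)
      rw [dist_toHomeomorph_zpow, sub_zero, map_smul, ← horb, norm_smul,
        Real.norm_of_nonneg ht.le] at hn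
      have h1 : ‖y n - y' n‖ < M + M' + 1 := by
        linarith [norm_sub_le (y n) (y' n), hM n, hM' n]
      have h2 := mul_lt_mul_of_pos_left h1 ht
      rw [div_mul_cancel₀ _ (by positivity)] at h2
      linarith
    funext n
    rw [← sub_eq_zero, horb, h0, map_zero]

/-- For `|μ| = 1`, solving `μ v - S v = w` amounts to solving the inhomogeneous equation for the
sequence `n ↦ μ ^ n w`: the bounded solution `y` satisfies `y (n + 1) = μ y n` by uniqueness. -/
theorem HasUniqueBoundedSolutions.isHyperbolic {Y : Type*} [NormedAddCommGroup Y]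
    [NormedSpace ℂ Y] [CompleteSpace Y] {S : Y →L[ℂ] Y} (h : HasUniqueBoundedSolutions S) :
    IsHyperbolic S := by
  rw [IsHyperbolic, Set.eq_empty_iff_forall_notMem]
  rintro μ ⟨hspec, hμ⟩
  have hμ : ‖μ‖ = 1 := hμ
  have hμ0 : μ ≠ 0 := norm_ne_zero_iff.1 (by rw [hμ]; exact one_ne_zero)
  have hnorm : ∀ (n : ℤ) (v : Y), ‖μ ^ n • v‖ = ‖v‖ := fun n v => by
    rw [norm_smul, norm_zpow, hμ, one_zpow, one_mul]
  refine hspec (spectrum.mem_resolventSet_iff.2 (ContinuousLinearMap.isUnit_iff_bijective.2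
    ⟨(injective_iff_map_eq_zero _).2 fun v hv => ?_, fun w => ?_⟩))
  · have hSv : μ • v = S v := by simpa [Algebra.algebraMap_eq_smul_one, sub_eq_zero] using hv
    obtain ⟨y, -, huniq⟩ := h (fun _ => 0) ⟨0, fun _ => by simp⟩
    have h1 := huniq (fun n => μ ^ n • v) ⟨⟨‖v‖, fun n => (hnorm n v).le⟩, fun n => by
      beta_reduce
      rw [map_smul, ← hSv, smul_smul, zpow_add_one₀ hμ0, add_zero]⟩
    have h2 := huniq (fun _ => 0) ⟨⟨0, fun _ => by simp⟩, fun n => by simp⟩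
    simpa using congrFun (h1.trans h2.symm) 0
  · obtain ⟨y, ⟨⟨C, hC⟩, hy⟩, huniq⟩ := h (fun n => μ ^ n • w) ⟨‖w‖, fun n => (hnorm n w).le⟩
    have h1 := huniq (fun n => μ⁻¹ • y (n + 1)) ⟨⟨C, fun n => by
      rw [← zpow_neg_one, hnorm]; exact hC _⟩, fun n => by
        beta_reduce
        rw [hy (n + 1), smul_add, map_smul, smul_smul, zpow_add_one₀ hμ0, mul_comm (μ ^ n),
          inv_mul_cancel_left₀ hμ0]⟩
    have h2 : y (0 + 1) = μ • y 0 := by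
      rw [← congrFun h1 0, smul_smul, mul_inv_cancel₀ hμ0, one_smul]
    have h3 := hy 0
    rw [h2, zpow_zero, one_smul] at h3
    refine ⟨y 0, ?_⟩
    simp [Algebra.algebraMap_eq_smul_one, h3]

end BoundedSolutions

/-! ### Hyperbolic operators and complexifications -/

section Hyperbolic

/-- A dichotomy of a hyperbolic complex operator `S` descends to a real operator `T` that is a
retract of `S`. -/
theorem exists_isDichotomy_of_isHyperbolic {X Y : Type*} [NormedAddCommGroup X] [NormedSpace ℝ X]
    [NormedAddCommGroup Y] [NormedSpace ℂ Y] [CompleteSpace Y] {T : X ≃L[ℝ] X} {S : Y ≃L[ℂ] Y}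
    (hS : IsHyperbolic (S : Y →L[ℂ] Y)) (ι : X →L[ℝ] Y) (ρ : Y →L[ℝ] X)
    (hρι : ∀ x, ρ (ι x) = x) (hι : ∀ x, ι (T x) = S (ι x)) (hρ : ∀ y, ρ (S y) = T (ρ y)) :
    ∃ P K β, IsDichotomy T P K β := by
  let u : (Y →L[ℂ] Y)ˣ := (ContinuousLinearEquiv.unitsEquiv ℂ Y).symm S
  have hu : ∀ (n : ℤ) (y : Y), ((u ^ n : (Y →L[ℂ] Y)ˣ) : Y →L[ℂ] Y) y = (S ^ n) y := fun n y => by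
    rw [← ContinuousLinearEquiv.unitsEquiv_apply, map_zpow, MulEquiv.apply_symm_apply]
  obtain ⟨p, K, β, hβ0, hβ1, hcomm, hK⟩ := exists_riesz_projection u hS
  have hcomm' : ∀ y, p (S y) = S (p y) := fun y =>
    (congrArg (fun f : Y →L[ℂ] Y => f y) hcomm.eq).symm
  have hpow := map_zpow_apply_of_semiconj (S := S) (T := T) (f := ρ) hρ
  have hKβ : ∀ n : ℕ, 0 ≤ K * β ^ n := fun n => (norm_nonneg _).trans (hK n).1
  have hmain : ∀ (n : ℕ) (q : Y →L[ℂ] Y) (x : X), ‖q‖ ≤ K * β ^ n →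
      ‖ρ (q (ι x))‖ ≤ (‖ρ‖ * K * ‖ι‖ + 1) * β ^ n * ‖x‖ := fun n q x hq =>
    calc ‖ρ (q (ι x))‖ ≤ ‖ρ‖ * ((K * β ^ n) * (‖ι‖ * ‖x‖)) := by
          refine (ρ.le_opNorm _).trans (mul_le_mul_of_nonneg_left ?_ (norm_nonneg _))
          exact (q.le_opNorm _).trans (mul_le_mul hq (ι.le_opNorm x) (norm_nonneg _) (hKβ n))
      _ ≤ ‖ρ‖ * ((K * β ^ n) * (‖ι‖ * ‖x‖)) + β ^ n * ‖x‖ :=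
          le_add_of_nonneg_right (by positivity)
      _ = (‖ρ‖ * K * ‖ι‖ + 1) * β ^ n * ‖x‖ := by ring
  have hK0 : 0 ≤ K := by simpa using hKβ 0
  refine ⟨ρ.comp ((p.restrictScalars ℝ).comp ι), ‖ρ‖ * K * ‖ι‖ + 1, β,
    le_add_of_nonneg_left (by positivity), hβ0, hβ1, fun x => ?_, fun n x => ?_, fun n x => ?_⟩
  · simp [hι, hcomm', hρ]
  · have h1 := hmain n _ x (hK n).1
    rw [mul_apply_eq_comp, hu, hpow] at h1
    exact h1
  · have h1 := hmain n _ x (hK n).2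
    rw [mul_apply_eq_comp, hu, hpow] at h1
    simpa [hρι] using h1

variable {X : Type*} [NormedAddCommGroup X] [NormedSpace ℝ X]

namespace Complexification

theorem norm_le_add (z : Complexification X) : ‖z‖ ≤ ‖z.re‖ + ‖z.im‖ :=
  ciSup_le (norm_rotate_le_add z)

theorem real_smul_re (t : ℝ) (z : Complexification X) : (t • z).re = t • z.re := by
  change ((t : ℂ) • z).re = t • z.re
  rw [smul_re, Complex.ofReal_re, Complex.ofReal_im, zero_smul, sub_zero]

theorem real_smul_im (t : ℝ) (z : Complexification X) : (t • z).im = t • z.im := by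
  change ((t : ℂ) • z).im = t • z.im
  rw [smul_im, Complex.ofReal_re, Complex.ofReal_im, zero_smul, zero_add]

variable (X) in
/-- The real part, as a continuous real-linear map. -/
noncomputable def reCLM : Complexification X →L[ℝ] X :=
  LinearMap.mkContinuous
    { toFun := re
      map_add' := fun _ _ => rfl
      map_smul' := real_smul_re } 1 fun z => by
    rw [one_mul]; exact norm_re_le z

variable (X) in
/-- The imaginary part, as a continuous real-linear map. -/
noncomputable def imCLM : Complexification X →L[ℝ] X :=
  LinearMap.mkContinuous
    { toFun := im
      map_add' := fun _ _ => rfl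
      map_smul' := real_smul_im } 1 fun z => by
    rw [one_mul]; exact norm_im_le z

variable (X) in
/-- The inclusion `x ↦ x + i 0`, as a continuous real-linear map. -/
noncomputable def ofRealCLM : X →L[ℝ] Complexification X :=
  LinearMap.mkContinuous
    { toFun := fun x => ⟨x, 0⟩
      map_add' := fun x y => by ext <;> simp
      map_smul' := fun t x => by
        ext
        · exact (real_smul_re t (⟨x, 0⟩ : Complexification X)).symm
        · exact ((real_smul_im t (⟨x, 0⟩ : Complexification X)).trans (smul_zero t)).symm } 1 fun x => by
    rw [one_mul]; simpa using norm_le_add (⟨x, 0⟩ : Complexification X)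

instance completeSpace [CompleteSpace X] : CompleteSpace (Complexification X) := by
  refine Metric.complete_of_cauchySeq_tendsto fun u hu => ?_
  obtain ⟨a, ha⟩ := cauchySeq_tendsto_of_complete
    ((reCLM X).uniformContinuous.comp_cauchySeq hu)
  obtain ⟨b, hb⟩ := cauchySeq_tendsto_of_complete
    ((imCLM X).uniformContinuous.comp_cauchySeq hu)
  refine ⟨⟨a, b⟩, tendsto_iff_norm_sub_tendsto_zero.2 ?_⟩
  have h := (tendsto_iff_norm_sub_tendsto_zero.1 ha).add (tendsto_iff_norm_sub_tendsto_zero.1 hb)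
  rw [add_zero] at h
  refine squeeze_zero (fun _ => norm_nonneg _) (fun n => (norm_le_add _).trans_eq ?_) h
  simp [sub_eq_add_neg, reCLM, imCLM]

end Complexification

/-- The complexification of an invertible operator is invertible. -/
noncomputable def complexifyEquiv (T : X ≃L[ℝ] X) : Complexification X ≃L[ℂ] Complexification X :=
  ContinuousLinearEquiv.equivOfInverse (complexify (T : X →L[ℝ] X))
    (complexify (T.symm : X →L[ℝ] X))
    (fun z => Complexification.ext (T.symm_apply_apply z.re) (T.symm_apply_apply z.im))
    (fun z => Complexification.ext (T.apply_symm_apply z.re) (T.apply_symm_apply z.im))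

/-- The inhomogeneous equation for the complexification splits into its real and imaginary
parts. -/
theorem HasUniqueBoundedSolutions.complexify {T : X →L[ℝ] X} (h : HasUniqueBoundedSolutions T) :
    HasUniqueBoundedSolutions (complexify T) := by
  rintro z ⟨C, hC⟩
  obtain ⟨a, ⟨⟨A, hA⟩, ha⟩, hau⟩ :=
    h (fun n => (z n).re) ⟨C, fun n => (Complexification.norm_re_le _).trans (hC n)⟩
  obtain ⟨b, ⟨⟨B, hB⟩, hb⟩, hbu⟩ :=
    h (fun n => (z n).im) ⟨C, fun n => (Complexification.norm_im_le _).trans (hC n)⟩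
  refine ⟨fun n => ⟨a n, b n⟩, ⟨⟨A + B, fun n => ?_⟩, fun n => ?_⟩, ?_⟩
  · exact (Complexification.norm_le_add _).trans (add_le_add (hA n) (hB n))
  · exact Complexification.ext (ha n) (hb n)
  · rintro y ⟨⟨M, hM⟩, hy⟩
    have h1 := hau (fun n => (y n).re) ⟨⟨M, fun n => (Complexification.norm_re_le _).trans (hM n)⟩,
      fun n => congrArg Complexification.re (hy n)⟩
    have h2 := hbu (fun n => (y n).im) ⟨⟨M, fun n => (Complexification.norm_im_le _).trans (hM n)⟩,
      fun n => congrArg Complexification.im (hy n)⟩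
    funext n
    exact Complexification.ext (congrFun h1 n) (congrFun h2 n)

end Hyperbolic

/-- Both the complex and the real case of the equivalence follow once `H` implies a dichotomy and
is implied by the unique solvability of the inhomogeneous equation. -/
theorem tfae_of_dichotomy {X : Type*} [NormedAddCommGroup X] [NormedSpace ℝ X] [CompleteSpace X]
    {T : X ≃L[ℝ] X} {H : Prop} (h1 : H → ∃ P K β, IsDichotomy T P K β)
    (h2 : HasUniqueBoundedSolutions T → H) :
    List.TFAE [H, HasHyperbolicCoordinates T.toHomeomorph,
      IsExpansive T.toHomeomorph ∧ HasShadowing T.toHomeomorph] := by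
  tfae_have 1 → 2 := fun h => by
    obtain ⟨P, K, β, hP⟩ := h1 h
    exact hP.hasHyperbolicCoordinates
  tfae_have 2 → 3 := fun h => by
    obtain ⟨P, K, β, hP⟩ := exists_isDichotomy_of_hasHyperbolicCoordinates h
    exact ⟨hP.isExpansive, hP.hasShadowing⟩
  tfae_have 3 → 1 := fun h =>
    h2 (hasUniqueBoundedSolutions_of_isExpansive_of_hasShadowing h.1 h.2)
  tfae_finish

end LinearDynamics

theorem theorem3p1 :
    (∀ (X : Type*) [NormedAddCommGroup X] [NormedSpace ℂ X] [CompleteSpace X] (T : X ≃L[ℂ] X),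
      List.TFAE [
        LinearDynamics.IsHyperbolic (T : X →L[ℂ] X),
        LinearDynamics.HasHyperbolicCoordinates T.toHomeomorph,
        LinearDynamics.IsExpansive T.toHomeomorph ∧
          LinearDynamics.HasShadowing T.toHomeomorph]) ∧
    (∀ (X : Type*) [NormedAddCommGroup X] [NormedSpace ℝ X] [CompleteSpace X] (T : X ≃L[ℝ] X),
      List.TFAE [
        LinearDynamics.IsHyperbolicReal (T : X →L[ℝ] X),
        LinearDynamics.HasHyperbolicCoordinates T.toHomeomorph,
        LinearDynamics.IsExpansive T.toHomeomorph ∧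
          LinearDynamics.HasShadowing T.toHomeomorph]) := by
  refine ⟨fun X _ _ _ T => ?_, fun X _ _ _ T => ?_⟩
  · refine LinearDynamics.tfae_of_dichotomy (T := T.restrictScalars ℝ) (fun h => ?_) fun h => ?_
    · exact LinearDynamics.exists_isDichotomy_of_isHyperbolic h (ContinuousLinearMap.id ℝ X)
        (ContinuousLinearMap.id ℝ X) (fun _ => rfl) (fun _ => rfl) (fun _ => rfl)
    · exact LinearDynamics.HasUniqueBoundedSolutions.isHyperbolic (S := (T : X →L[ℂ] X)) h
  · refine LinearDynamics.tfae_of_dichotomy (fun h => ?_) fun h => ?_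
    · exact LinearDynamics.exists_isDichotomy_of_isHyperbolic
        (S := LinearDynamics.complexifyEquiv T) h
        (LinearDynamics.Complexification.ofRealCLM X) (LinearDynamics.Complexification.reCLM X)
        (fun _ => rfl) (fun x => LinearDynamics.Complexification.ext rfl (map_zero T).symm)
        (fun _ => rfl)
    · exact (LinearDynamics.HasUniqueBoundedSolutions.complexify (T := (T : X →L[ℝ] X))
        h).isHyperbolic
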